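/- Let $G=(V,E)$ be a finite simple undirected graph (not necessarily connected) with $n=|V|$ vertices, called processes, which are linearly ordered (by distinct identifiers). Let $N(i)$ be the set of neighbours of $i$. Each process $i$ has a boolean variable $m_i$ and a variable $p_i\in\{\mathrm{null}\}\cup N(i)$; a configuration assigns a value to each of these variables. Write $\mathrm{PRmarried}(i)$ for: there is $j\in N(i)$ with $p_i=j$ and $p_j=i$. The algorithm consists of the following four rules at each process $i$. - Update: if $m_i\neq \mathrm{PRmarried}(i)$, then set $m_i:=\mathrm{PRmarried}(i)$. - Marriage: if $m_i=\mathrm{PRmarried}(i)$, $p_i=\mathrm{null}$, and there is $j\in N(i)$ with $p_j=i$, then set $p_i:=j$ (for any such $j$). - Seduction: if $m_i=\mathrm{PRmarried}(i)$, $p_i=\mathrm{null}$, $p_k\ne i$ for all $k\in N(i)$, and the set $S=\{j\in N(i): p_j=\mathrm{null},\ j>i,\ \neg m_j\}$ is nonempty, then set $p_i:=\max S$. - Abandonment: if $m_i=\mathrm{PRmarried}(i)$, $p_i=j$, $p_j\ne i$, and ($m_j$ or $j\le i$), then set $p_i:=\mathrm{null}$. A process is eligible in a configuration if the guard (the "if"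 part) of one of its rules is true there; a configuration is stable if no process is eligible. In one step, the processes of some nonempty set each execute one of their enabled rules simultaneously, all rules being evaluated in the configuration before the step. A computation is a maximal sequence of configurations, starting from an arbitrary one, in which each configuration is obtained from the previous one by a step; so it is infinite or ends in a stable configuration. It is a computation under the fair distributed daemon if every rule of a process that is continuously enabled from some point on is eventually executed by that process. A round is a shortest nonempty segment of the computation during which every process that is eligible at the beginning of the segment either makes a move or is ineligible at some time; the computation is divided into consecutive rounds from its start. **Theorem.** Under the fair distributed daemon, the algorithm stabilizes after at most $2n+1$ rounds: in every such computation there is $k\le 2n+1$ such that the first $k$ rounds exist and the configuration at the end of the $k$-th round (the initial configuration if $k=0$) is stable and defines a maximal matching. That is, the set of the edges $\{i,j\}\in E$ with $p_i=j$, $p_j=i$, and $m_i$, $m_j$ both true is a matching of $G$, and no proper superset of it is a matching of $G$. -/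

import Mathlib

namespace SelfStab

variable {V : Type*}

/-- A configuration: every process `i` holds a pointer `p i`, which is null or one of its
neighbours, and a boolean `m i`. -/
structure Config (G : SimpleGraph V) where
  p : V → Option V
  m : V → Bool
  p_adj : ∀ i j, p i = some j → G.Adj i j

/-- The four rules of the algorithm. -/
inductive Rule
  | update
  | marriage
  | seduction
  | abandonment

variable {G : SimpleGraph V}

/-- `PRmarried(i)`. -/
def Married (c : Config G) (i : V) : Prop :=
  ∃ j, G.Adj i j ∧ c.p i = some j ∧ c.p j = some i

/-- The variable `m i` agrees with `PRmarried(i)`. -/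
def MCorrect (c : Config G) (i : V) : Prop :=
  c.m i = true ↔ Married c i

/-- The neighbours that `i` may seduce. -/
def seducible [LinearOrder V] (c : Config G) (i : V) : Set V :=
  {j | G.Adj i j ∧ c.p j = none ∧ i < j ∧ c.m j = false}

/-- The guard of a rule at process `i`. -/
def Guard [LinearOrder V] (c : Config G) (i : V) : Rule → Prop
  | .update => ¬ MCorrect c i
  | .marriage => MCorrect c i ∧ c.p i = none ∧ ∃ j, G.Adj i j ∧ c.p j = some i
  | .seduction => MCorrect c i ∧ c.p i = none ∧ (∀ k, G.Adj i k → c.p k ≠ some i) ∧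
      ∃ j, j ∈ seducible c i
  | .abandonment => MCorrect c i ∧
      ∃ j, c.p i = some j ∧ c.p j ≠ some i ∧ (c.m j = true ∨ j ≤ i)

/-- The command of a rule at process `i`, evaluated in `c`, may give the variables of `i` the
values that they have in `c'`. (In the marriage rule, `j` is any neighbour that points to `i`.) -/
def Command [LinearOrder V] (c : Config G) (i : V) (c' : Config G) : Rule → Prop
  | .update => (c'.m i = true ↔ Married c i) ∧ c'.p i = c.p i
  | .marriage => c'.m i = c.m i ∧ ∃ j, G.Adj i j ∧ c.p j = some i ∧ c'.p i = some j
  | .seduction => c'.m i = c.m i ∧ ∃ j, IsGreatest (seducible c i) j ∧ c'.p i = some j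
  | .abandonment => c'.m i = c.m i ∧ c'.p i = none

/-- A process is eligible if one of its rules is enabled. -/
def Eligible [LinearOrder V] (c : Config G) (i : V) : Prop :=
  ∃ r, Guard c i r

/-- A configuration is stable if no process can execute a move. -/
def Stable [LinearOrder V] (c : Config G) : Prop :=
  ∀ i, ¬ Eligible c i

/-- One step: a nonempty set of processes simultaneously execute enabled rules, all of them
evaluated in `c`. Here `a i` is the rule that `i` executes, if any; other processes keep their
variables. -/
def Step [LinearOrder V] (c : Config G) (a : V → Option Rule) (c' : Config G) : Prop :=
  (∃ i r, a i = some r) ∧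
  (∀ i r, a i = some r → Guard c i r ∧ Command c i c' r) ∧
  (∀ i, a i = none → c'.p i = c.p i ∧ c'.m i = c.m i)

/-- A computation: a maximal sequence of configurations `conf 0, conf 1, …`, with `length` steps
(`⊤` if it is infinite), `act k` telling which rules are executed in step `k`. The values of `conf`
after index `length` and those of `act` from index `length` on carry no meaning. -/
structure Computation [LinearOrder V] (G : SimpleGraph V) where
  length : ℕ∞
  conf : ℕ → Config G
  act : ℕ → V → Option Rule
  step : ∀ k : ℕ, (k : ℕ∞) < length → Step (conf k) (act k) (conf (k + 1))
  maximal : ∀ k : ℕ, (k : ℕ∞) = length → Stable (conf k)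

/-- A daemon is a predicate on computations. -/
abbrev Daemon [LinearOrder V] (G : SimpleGraph V) := Computation G → Prop

/-- The fair distributed daemon: in each step any nonempty set of enabled actions may be executed
(this is the content of `Step`), but an action that is continuously enabled from some point on is
eventually executed. -/
def fairDistributed [LinearOrder V] (G : SimpleGraph V) : Daemon G := fun e =>
  ∀ (i : V) (r : Rule) (k : ℕ), (k : ℕ∞) ≤ e.length →
    (∀ t : ℕ, k ≤ t → (t : ℕ∞) ≤ e.length → Guard (e.conf t) i r) →
    ∃ t : ℕ, k ≤ t ∧ (t : ℕ∞) < e.length ∧ e.act t i = some r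

/-- The segment of `e` from `conf a` to `conf b` is a round: it is the shortest nonempty segment
starting at `conf a` during which every process that is eligible in `conf a` makes a move or
is ineligible at some time. -/
def IsRound [LinearOrder V] (e : Computation G) (a b : ℕ) : Prop :=
  IsLeast {b : ℕ | a < b ∧ (b : ℕ∞) ≤ e.length ∧ ∀ i, Eligible (e.conf a) i →
    (∃ t, a ≤ t ∧ t < b ∧ ∃ r, e.act t i = some r) ∨
    (∃ t, a ≤ t ∧ t ≤ b ∧ ¬ Eligible (e.conf t) i)} b

/-- The first `k` rounds of `e`, taken one after the other from the start, end at `conf t`. -/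
inductive RoundsEnd [LinearOrder V] (e : Computation G) : ℕ → ℕ → Prop
  | zero : RoundsEnd e 0 0
  | succ {k a b : ℕ} : RoundsEnd e k a → IsRound e a b → RoundsEnd e (k + 1) b

/-- A set of edges of `G`, no two of which share an end point. -/
def IsMatchingSet (G : SimpleGraph V) (M : Set (Sym2 V)) : Prop :=
  M ⊆ G.edgeSet ∧ ∀ x ∈ M, ∀ y ∈ M, ∀ v, v ∈ x → v ∈ y → x = y

/-- The set of edges defined by the `p`- and `m`-values. -/
def matchingOf (c : Config G) : Set (Sym2 V) :=
  {x | ∃ i j, x = s(i, j) ∧ G.Adj i j ∧ c.p i = some j ∧ c.p j = some i ∧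
    c.m i = true ∧ c.m j = true}

/-- The computation has stabilized in `c`: no process can move, and `c` defines a matching that is
maximal, that is, no proper superset of it is a matching. -/
def Stabilized [LinearOrder V] (c : Config G) : Prop :=
  Stable c ∧ Maximal (IsMatchingSet G) (matchingOf c)

end SelfStab

/-!
Two processes that point at each other never change their pointers again, so the set of married
processes only grows, and it grows by pairs. Everything rests on what happens while this set is
constant. Then a correct `m i` stays correct, and every pointer that an unmarried process `i` sets
is settled (`Settled`): it goes to an unmarried `j > i` with `m j` false, and `i` has no reason to
abandon it as long as nobody marries. Seduction gives such a pointer by its guard. A marriage move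
of `i` towards `j` that fails, because `j` abandons `i` in the same step, gives one as well, since
`j` has the right to do so only if `i < j` (`settled_of_act`).

*Termination.* While the married set is constant, each move corrects `m i`, replaces an unsettled
pointer by null, or replaces null by a settled pointer, and nothing is ever undone. Hence a natural
number attached to the configuration decreases in every step (`measure_lt_of_step`), and every
computation is finite, whatever the daemon does. In particular every configuration that is not
stable begins a round.

*Counting rounds.* Any four consecutive rounds produce a new married pair (`exists_new_married`).
Indeed, suppose that they do not. After the first round all `m i` are correct, and after the second
all pointers of unmarried processes are settled. The next step can then only set new pointers, so
some unmarried process points somewhere at the end of the third round. Settled pointers increase,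
so the greatest process that is pointed at by an unmarried one has a null pointer. It is able to
marry throughout the fourth round, so it moves and is married, a contradiction. After `4 q` rounds
there are therefore at least `2 q` married processes. If `n = 2 q`, all processes are married after
`4 q` rounds, and one more round of updates makes the configuration stable. If `n = 2 q + 1`, there
cannot be `4 q + 4 = 2 n + 2` rounds, so the configuration after `2 n + 1` rounds is stable.

*Stable configurations.* There all `m i` are correct and all pointers of unmarried processes are
settled, so by the same maximality argument all of them are null. Two adjacent unmarried processes
would then allow a seduction, hence the matching is maximal.
-/

namespace SelfStab

/-! ### Married processes and their matching -/

section Basic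

variable {V : Type*} {G : SimpleGraph V} {c : Config G} {i : V}

lemma not_married_of_none (h : c.p i = none) : ¬ Married c i := by
  rintro ⟨j, -, hj, -⟩
  simp [h] at hj

/-- A married process is married to the process it points at. -/
lemma Married.back {j : V} (h : Married c i) (hj : c.p i = some j) : c.p j = some i := by
  obtain ⟨k, -, hk, hki⟩ := h
  have : k = j := by simpa [hj] using hk.symm
  exact this ▸ hki

lemma MCorrect.m_eq_false (h : MCorrect c i) (hi : ¬ Married c i) : c.m i = false := by
  rw [← Bool.not_eq_true]
  exact fun hm => hi (h.1 hm)

lemma isMatchingSet_matchingOf (c : Config G) : IsMatchingSet G (matchingOf c) := by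
  refine ⟨?_, ?_⟩
  · rintro _ ⟨i, j, rfl, hadj, -⟩
    exact hadj
  -- Every edge of the matching is determined by the pointer of any of its end points.
  · have key : ∀ x ∈ matchingOf c, ∀ v ∈ x, ∃ w, x = s(v, w) ∧ c.p v = some w := by
      rintro _ ⟨i, j, rfl, -, hij, hji, -⟩ v hv
      rcases Sym2.mem_iff.1 hv with rfl | rfl
      · exact ⟨j, rfl, hij⟩
      · exact ⟨i, Sym2.eq_swap, hji⟩
    intro x hx y hy v hvx hvy
    obtain ⟨w, rfl, hw⟩ := key x hx v hvx
    obtain ⟨w', rfl, hw'⟩ := key y hy v hvy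
    obtain rfl : w = w' := by simpa [hw] using hw'
    rfl

open Classical in
/-- The set of married processes. -/
noncomputable def marriedSet [Fintype V] (c : Config G) : Finset V := {i | Married c i}

@[simp] lemma mem_marriedSet [Fintype V] : i ∈ marriedSet c ↔ Married c i := by
  simp [marriedSet]

end Basic

variable {V : Type*} [LinearOrder V] {G : SimpleGraph V}

/-! ### Single steps -/

/-- The pointer of `i` is null, or it goes to an unmarried process `j > i` with `m j` false, so that
`i` may wait for `j` to accept. -/
def Settled (c : Config G) (i : V) : Prop :=
  ∀ j, c.p i = some j → i < j ∧ c.m j = false ∧ ¬ Married c j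

section Step

variable {c c' : Config G} {a : V → Option Rule} {i j : V}

/-- A process whose pointer changes from a non-null value has abandoned it. -/
lemma Step.abandonment_of_ne (h : Step c a c') (hj : c.p i = some j) (hne : c'.p i ≠ some j) :
    MCorrect c i ∧ c.p j ≠ some i ∧ (c.m j = true ∨ j ≤ i) ∧ c'.m i = c.m i := by
  rcases ha : a i with _ | r
  · exact absurd ((h.2.2 i ha).1.trans hj) hne
  · obtain ⟨hg, hc⟩ := h.2.1 i r ha
    cases r with
    | update => exact absurd (hc.2.trans hj) hne
    | marriage => exact absurd hg.2.1 (by simp [hj])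
    | seduction => exact absurd hg.2.1 (by simp [hj])
    | abandonment =>
      obtain ⟨h1, k, hk, h2, h3⟩ := hg
      obtain rfl : j = k := by simpa [hj] using hk
      exact ⟨h1, h2, h3, hc.1⟩

/-- A married pair keeps its pointers. -/
lemma Step.pair (h : Step c a c') (hij : c.p i = some j) (hji : c.p j = some i) :
    c'.p i = some j := by
  by_contra hne
  exact (h.abandonment_of_ne hij hne).2.1 hji

lemma Step.m_eq_false (h : Step c a c') (hm : c.m i = false) (hi : ¬ Married c i) :
    c'.m i = false := by
  rcases ha : a i with _ | r
  · exact (h.2.2 i ha).2.trans hm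
  · obtain ⟨-, hc⟩ := h.2.1 i r ha
    cases r with
    | update => rw [← Bool.not_eq_true]; exact fun h' => hi (hc.1.1 h')
    | marriage => exact hc.1.trans hm
    | seduction => exact hc.1.trans hm
    | abandonment => exact hc.1.trans hm

lemma Step.mcorrect (h : Step c a c') (hM : ∀ k, Married c' k ↔ Married c k)
    (hi : MCorrect c i) : MCorrect c' i := by
  unfold MCorrect at *
  rw [hM]
  rcases ha : a i with _ | r
  · rw [(h.2.2 i ha).2, hi]
  · obtain ⟨hg, hc⟩ := h.2.1 i r ha
    cases r with
    | update => exact hc.1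
    | marriage => rw [hc.1, hi]
    | seduction => rw [hc.1, hi]
    | abandonment => rw [hc.1, hi]

/-- After any move, `m i` is correct, since every rule but the update presupposes it. -/
lemma Step.mcorrect_of_act (h : Step c a c') (hM : ∀ k, Married c' k ↔ Married c k)
    {r : Rule} (ha : a i = some r) : MCorrect c' i := by
  by_cases hi : MCorrect c i
  · exact h.mcorrect hM hi
  obtain ⟨hg, hc⟩ := h.2.1 i r ha
  cases r with
  | update => exact hc.1.trans (hM i).symm
  | marriage => exact absurd hg.1 hi
  | seduction => exact absurd hg.1 hi
  | abandonment => exact absurd hg.1 hi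

lemma Step.settled_pointer (h : Step c a c') (hs : Settled c i) (hj : c.p i = some j) :
    c'.p i = some j := by
  by_contra hne
  obtain ⟨h1, h2, -⟩ := hs j hj
  rcases (h.abandonment_of_ne hj hne).2.2.1 with h3 | h3
  · simp [h2] at h3
  · exact absurd h1 h3.not_gt

/-- When nobody marries, a process with null pointer is settled after the step, whether it moves
or not. -/
lemma Step.settled_of_none (h : Step c a c') (hM : ∀ k, Married c' k ↔ Married c k)
    (hi : c.p i = none) : Settled c' i := by
  intro j hj
  rcases ha : a i with _ | r
  · simp [(h.2.2 i ha).1, hi] at hj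
  obtain ⟨hg, hc⟩ := h.2.1 i r ha
  have hui : ¬ Married c i := not_married_of_none hi
  cases r with
  | update => simp [hc.2, hi] at hj
  | marriage =>
    obtain ⟨-, k, hk, hki, hk'⟩ := hc
    obtain rfl : j = k := by simpa [hj] using hk'
    -- The marriage fails, so `j` abandons `i` in the same step; as `m i` is false, `i < j`.
    have hne : c'.p j ≠ some i := fun h' => hui ((hM i).1 ⟨j, hk, hj, h'⟩)
    obtain ⟨h1, h2, h3, h4⟩ := h.abandonment_of_ne hki hne
    have huj : ¬ Married c j := fun h' => h2 (h'.back hki)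
    refine ⟨?_, h4.trans (h1.m_eq_false huj), fun h' => huj ((hM j).1 h')⟩
    rcases h3 with h3 | h3
    · simp [hg.1.m_eq_false hui] at h3
    · exact lt_of_le_of_ne h3 hk.ne
  | seduction =>
    obtain ⟨-, k, ⟨⟨-, hkn, hlt, hm⟩, -⟩, hk'⟩ := hc
    obtain rfl : j = k := by simpa [hj] using hk'
    have huj : ¬ Married c j := not_married_of_none hkn
    exact ⟨hlt, h.m_eq_false hm huj, fun h' => huj ((hM j).1 h')⟩
  | abandonment => simp [hc.2] at hj

lemma Step.settled (h : Step c a c') (hM : ∀ k, Married c' k ↔ Married c k)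
    (hs : Settled c i) : Settled c' i := by
  rcases hi : c.p i with _ | j
  · exact h.settled_of_none hM hi
  · intro k hk
    obtain rfl : j = k := by simpa [h.settled_pointer hs hi] using hk
    obtain ⟨h1, h2, h3⟩ := hs j hi
    exact ⟨h1, h.m_eq_false h2 h3, fun h' => h3 ((hM j).1 h')⟩

/-- When nobody marries, every move but an update leaves the pointer settled. -/
lemma Step.settled_of_act (h : Step c a c') (hM : ∀ k, Married c' k ↔ Married c k)
    {r : Rule} (ha : a i = some r) (hi : MCorrect c i) : Settled c' i := by
  obtain ⟨hg, hc⟩ := h.2.1 i r ha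
  cases r with
  | update => exact absurd hi hg
  | marriage => exact h.settled_of_none hM hg.2.1
  | seduction => exact h.settled_of_none hM hg.2.1
  | abandonment => intro j hj; simp [hc.2] at hj

/-- A guard of abandonment excludes settled and married processes. -/
lemma Guard.not_settled (h : Guard c i .abandonment) : ¬ Married c i ∧ ¬ Settled c i := by
  obtain ⟨-, j, hj, h2, h3⟩ := h
  refine ⟨fun h' => h2 (h'.back hj), fun hs => ?_⟩
  obtain ⟨h4, h5, -⟩ := hs j hj
  rcases h3 with h3 | h3
  · simp [h5] at h3
  · exact absurd h4 h3.not_gt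

/-- An unsettled unmarried process is eligible once all `m`-values are correct. -/
lemma eligible_of_not_settled (hc : ∀ k, MCorrect c k) (hi : ¬ Married c i)
    (hs : ¬ Settled c i) : Eligible c i := by
  unfold Settled at hs
  push Not at hs
  obtain ⟨j, hj, hbad⟩ := hs
  refine ⟨.abandonment, hc i, j, hj, fun h' => hi ⟨j, c.p_adj i j hj, hj, h'⟩, ?_⟩
  by_contra! hcon
  exact hcon.1 ((hc j).2 (hbad hcon.2 (by simpa using hcon.1)))

/-- When nobody marries and all unmarried processes are settled, a process with null pointer that
an unmarried process points at does not move: a marriage would succeed. -/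
lemma Step.act_eq_none (h : Step c a c') (hM : ∀ k, Married c' k ↔ Married c k)
    (hc : ∀ k, MCorrect c k) (hs : ∀ k, ¬ Married c k → Settled c k)
    (hj : c.p j = none) (hi : c.p i = some j) : a j = none := by
  by_contra hne
  obtain ⟨r, ha⟩ := Option.ne_none_iff_exists'.1 hne
  obtain ⟨hg, hcm⟩ := h.2.1 j r ha
  cases r with
  | update => exact hg (hc j)
  | marriage =>
    obtain ⟨-, k, hk, hkj, hk'⟩ := hcm
    have huk : ¬ Married c k := fun h' => by simp [h'.back hkj] at hj
    exact not_married_of_none hj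
      ((hM j).1 ⟨k, hk, hk', h.settled_pointer (hs k huk) hkj⟩)
  | seduction => exact hg.2.2.1 i (c.p_adj i j hi).symm hi
  | abandonment =>
    obtain ⟨-, k, hk, -⟩ := hg
    simp [hj] at hk

end Step

/-- If all unmarried processes are settled and one of them has a non-null pointer, then some
unmarried process points at a process with null pointer: settled pointers increase, so the greatest
process pointed at qualifies. -/
lemma exists_pointed_null [Finite V] {c : Config G} (hs : ∀ k, ¬ Married c k → Settled c k)
    {i j : V} (hi : ¬ Married c i) (hij : c.p i = some j) :
    ∃ i j, c.p i = some j ∧ c.p j = none := by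
  obtain ⟨j, ⟨i, hi, hij⟩, hmax⟩ := (Set.toFinite
    {j | ∃ i, ¬ Married c i ∧ c.p i = some j}).exists_maximal ⟨j, i, hi, hij⟩
  obtain ⟨-, -, huj⟩ := hs i hi j hij
  refine ⟨i, j, hij, ?_⟩
  by_contra hne
  obtain ⟨k, hk⟩ := Option.ne_none_iff_exists'.1 hne
  have hlt := (hs j huj k hk).1
  exact absurd (hmax ⟨j, huj, hk⟩ hlt.le) hlt.not_ge

/-! ### Stable configurations -/

lemma Stable.mcorrect {c : Config G} (h : Stable c) (i : V) : MCorrect c i := by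
  by_contra hi
  exact h i ⟨.update, hi⟩

lemma Stable.p_eq_none [Finite V] {c : Config G} (h : Stable c) {i : V} (hi : ¬ Married c i) :
    c.p i = none := by
  by_contra hne
  obtain ⟨j, hj⟩ := Option.ne_none_iff_exists'.1 hne
  have hs : ∀ k, ¬ Married c k → Settled c k := fun k hk => by
    by_contra hk'
    exact h k (eligible_of_not_settled h.mcorrect hk hk')
  obtain ⟨k, l, hkl, hl⟩ := exists_pointed_null hs hi hj
  exact h l ⟨.marriage, h.mcorrect l, hl, k, (c.p_adj k l hkl).symm, hkl⟩

lemma Stable.married_or_married [Finite V] {c : Config G} (h : Stable c) {i j : V}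
    (hadj : G.Adj i j) : Married c i ∨ Married c j := by
  wlog hlt : i < j generalizing i j
  · exact (this hadj.symm (lt_of_le_of_ne (not_lt.1 hlt) hadj.ne')).symm
  by_contra! hu
  have hi := h.p_eq_none hu.1
  by_cases hk : ∃ k, G.Adj i k ∧ c.p k = some i
  · exact h i ⟨.marriage, h.mcorrect i, hi, hk⟩
  · push Not at hk
    exact h i ⟨.seduction, h.mcorrect i, hi, hk, j, hadj, h.p_eq_none hu.2, hlt,
      (h.mcorrect j).m_eq_false hu.2⟩

lemma Stable.stabilized [Finite V] {c : Config G} (h : Stable c) : Stabilized c := by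
  refine ⟨h, isMatchingSet_matchingOf c, ?_⟩
  intro M hM hle x hx
  have key : ∀ v ∈ x, Married c v → x ∈ matchingOf c := by
    rintro v hv ⟨w, hadj, hvw, hwv⟩
    have hmem : s(v, w) ∈ matchingOf c := ⟨v, w, rfl, hadj, hvw, hwv,
      (h.mcorrect v).2 ⟨w, hadj, hvw, hwv⟩, (h.mcorrect w).2 ⟨v, hadj.symm, hwv, hvw⟩⟩
    rwa [hM.2 x hx _ (hle hmem) v hv (Sym2.mem_mk_left v w)]
  have hxe := hM.1 hx
  induction x using Sym2.ind with
  | _ i j =>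
    rcases h.married_or_married hxe with hi | hj
    · exact key i (Sym2.mem_mk_left i j) hi
    · exact key j (Sym2.mem_mk_right i j) hj

/-! ### Termination -/

lemma Step.married {c c' : Config G} {a : V → Option Rule} (h : Step c a c') {i : V}
    (hi : Married c i) : Married c' i := by
  obtain ⟨j, hadj, hij, hji⟩ := hi
  exact ⟨j, hadj, h.pair hij hji, h.pair hji hij⟩

open Classical in
/-- How much `i` can still do while nobody marries: one for correcting `m i`, one for setting a
null pointer, two for giving up an unsettled pointer and setting a new one. -/
noncomputable def potential (c : Config G) (i : V) : ℕ :=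
  (if MCorrect c i then 0 else 1) +
    (if c.p i = none then 1 else if Married c i ∨ Settled c i then 0 else 2)

lemma potential_le_of_step {c c' : Config G} {a : V → Option Rule} (h : Step c a c')
    (hM : ∀ k, Married c' k ↔ Married c k) (i : V) :
    potential c' i + (if (a i).isSome then 1 else 0) ≤ potential c i := by
  have hcor : MCorrect c i → MCorrect c' i := h.mcorrect hM
  have hset : Settled c i → Settled c' i := h.settled hM
  rcases ha : a i with _ | r
  · have hp := (h.2.2 i ha).1
    simp only [potential, hp, hM]
    split_ifs <;> simp_all
  · obtain ⟨hg, hc⟩ := h.2.1 i r ha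
    have hcor' : MCorrect c' i := h.mcorrect_of_act hM ha
    cases r with
    | update =>
      have hp := hc.2
      have hn : ¬ MCorrect c i := hg
      simp only [potential, hp, hM]
      split_ifs <;> simp_all
    | marriage =>
      have hs := h.settled_of_none hM hg.2.1
      obtain ⟨-, k, -, -, hk⟩ := hc
      simp [potential, hcor', hs, hg.1, hg.2.1, hk]
    | seduction =>
      have hs := h.settled_of_none hM hg.2.1
      obtain ⟨-, k, -, hk⟩ := hc
      simp [potential, hcor', hs, hg.1, hg.2.1, hk]
    | abandonment =>
      have hns := hg.not_settled
      obtain ⟨h1, k, hk, -⟩ := hg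
      simp [potential, hcor', hc.2, h1, hns.1, hns.2, hk]

lemma potential_le_three (c : Config G) (i : V) : potential c i ≤ 3 := by
  unfold potential
  split_ifs <;> simp

section Measure

variable [Fintype V]

/-- A natural number that decreases in every step. The factor exceeds the greatest possible sum of
the potentials, so that a marriage outweighs whatever it does to them. -/
noncomputable def configMeasure (c : Config G) : ℕ :=
  (3 * Fintype.card V + 1) * (marriedSet c)ᶜ.card + ∑ i, potential c i

lemma measure_lt_of_step {c c' : Config G} {a : V → Option Rule} (h : Step c a c') :
    configMeasure c' < configMeasure c := by
  have hsub : marriedSet c ⊆ marriedSet c' := fun i hi => by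
    simpa using h.married (by simpa using hi)
  unfold configMeasure
  by_cases hM : ∀ k, Married c' k → Married c k
  · have hM' : ∀ k, Married c' k ↔ Married c k := fun k => ⟨hM k, h.married⟩
    have heq : marriedSet c' = marriedSet c := by ext k; simp [hM']
    rw [heq]
    obtain ⟨i, r, hi⟩ := h.1
    have hlt : ∑ i, potential c' i < ∑ i, potential c i := by
      refine Finset.sum_lt_sum (fun k _ => ?_) ⟨i, Finset.mem_univ i, ?_⟩
      · exact le_trans (Nat.le_add_right _ _) (potential_le_of_step h hM' k)
      · simpa [hi] using potential_le_of_step h hM' i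
    omega
  · push Not at hM
    obtain ⟨i, hi', hi⟩ := hM
    have hlt : (marriedSet c')ᶜ.card < (marriedSet c)ᶜ.card := by
      refine Finset.card_lt_card ((Finset.ssubset_iff_of_subset ?_).2 ⟨i, ?_, ?_⟩)
      · exact Finset.compl_subset_compl.2 hsub
      · simpa using hi
      · simpa using hi'
    have hle : ∑ i, potential c' i ≤ 3 * Fintype.card V := by
      calc ∑ i, potential c' i ≤ ∑ _i : V, 3 :=
            Finset.sum_le_sum fun i _ => potential_le_three c' i
        _ = 3 * Fintype.card V := by simp [mul_comm]
    calc (3 * Fintype.card V + 1) * (marriedSet c')ᶜ.card + ∑ i, potential c' i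
        < (3 * Fintype.card V + 1) * ((marriedSet c')ᶜ.card + 1) := by rw [mul_add]; omega
      _ ≤ (3 * Fintype.card V + 1) * (marriedSet c)ᶜ.card := Nat.mul_le_mul_left _ hlt
      _ ≤ _ := Nat.le_add_right _ _

lemma exists_length_eq (e : Computation G) : ∃ L : ℕ, (L : ℕ∞) = e.length := by
  by_contra hne
  have htop : e.length = ⊤ := by
    by_contra h
    exact hne ⟨_, ENat.natCast_toNat h⟩
  have hdec : ∀ k : ℕ, configMeasure (e.conf k) + k ≤ configMeasure (e.conf 0) := by
    intro k
    induction k with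
    | zero => simp
    | succ k ih =>
      have := measure_lt_of_step (e.step k (htop ▸ ENat.natCast_lt_top k))
      omega
  have := hdec (configMeasure (e.conf 0) + 1)
  omega

end Measure

/-! ### Rounds -/

section Rounds

variable {e : Computation G} {s t a b : ℕ}

lemma Computation.step' (e : Computation G) (h : t < b) (hb : (b : ℕ∞) ≤ e.length) :
    Step (e.conf t) (e.act t) (e.conf (t + 1)) :=
  e.step t (lt_of_lt_of_le (by exact_mod_cast h) hb)

lemma pair_mono (e : Computation G) (hst : s ≤ t) (ht : (t : ℕ∞) ≤ e.length) {i j : V}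
    (hij : (e.conf s).p i = some j) (hji : (e.conf s).p j = some i) :
    (e.conf t).p i = some j ∧ (e.conf t).p j = some i := by
  induction t, hst using Nat.le_induction with
  | base => exact ⟨hij, hji⟩
  | succ t hst ih =>
    obtain ⟨h1, h2⟩ := ih (le_trans (by exact_mod_cast t.le_succ) ht)
    have hs := e.step' t.lt_succ_self ht
    exact ⟨hs.pair h1 h2, hs.pair h2 h1⟩

lemma married_mono (e : Computation G) (hst : s ≤ t) (ht : (t : ℕ∞) ≤ e.length) {i : V}
    (hi : Married (e.conf s) i) : Married (e.conf t) i := by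
  obtain ⟨j, hadj, hij, hji⟩ := hi
  exact ⟨j, hadj, pair_mono e hst ht hij hji⟩

/-- An invariant of the steps in an interval holds throughout it. -/
lemma forall_of_step {P : ℕ → Prop} (hstep : ∀ t, a ≤ t → t < b → P t → P (t + 1)) (ha : P a) :
    ∀ t, a ≤ t → t ≤ b → P t := by
  intro t hat
  induction t, hat using Nat.le_induction with
  | base => exact fun _ => ha
  | succ s has ih => exact fun hsb => hstep s has hsb (ih (by omega))

/-- A goal `Q` of process `i` that is kept once reached, is reached by any move of `i`, and makes
`i` eligible as long as it is not reached, is reached at the end of a round. -/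
lemma IsRound.reaches (h : IsRound e a b) (i : V) (Q : ℕ → Prop)
    (hel : ∀ t, a ≤ t → t ≤ b → ¬ Q t → Eligible (e.conf t) i)
    (hkeep : ∀ t, a ≤ t → t < b → Q t → Q (t + 1))
    (hact : ∀ t, a ≤ t → t < b → ∀ r, e.act t i = some r → Q (t + 1)) : Q b := by
  obtain ⟨hab, -, hround⟩ := h.1
  have hfrom : ∀ t, a ≤ t → t ≤ b → Q t → Q b := fun t hat htb hQ =>
    forall_of_step (fun s hs hsb => hkeep s (hat.trans hs) hsb) hQ b htb le_rfl
  by_cases hQa : Q a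
  · exact hfrom a le_rfl hab.le hQa
  rcases hround i (hel a le_rfl hab.le hQa) with ⟨t, h1, h2, r, hr⟩ | ⟨t, h1, h2, hne⟩
  · exact hfrom (t + 1) (by omega) h2 (hact t h1 h2 r hr)
  · exact hfrom t h1 h2 (by_contra fun hQ => hne (hel t h1 h2 hQ))

lemma IsRound.mcorrect (h : IsRound e a b)
    (hM : ∀ t, a ≤ t → t < b → ∀ k, Married (e.conf (t + 1)) k ↔ Married (e.conf t) k) (i : V) :
    MCorrect (e.conf b) i := by
  refine h.reaches i (fun t => MCorrect (e.conf t) i) (fun t _ _ hQ => ⟨.update, hQ⟩) ?_ ?_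
  · intro t hat htb hQ
    exact (e.step' htb h.1.2.1).mcorrect (hM t hat htb) hQ
  · intro t hat htb r hr
    exact (e.step' htb h.1.2.1).mcorrect_of_act (hM t hat htb) hr

lemma exists_new_married [Finite V] {t₀ t₁ t₂ t₃ t₄ : ℕ} (h₁ : IsRound e t₀ t₁)
    (h₂ : IsRound e t₁ t₂) (h₃ : IsRound e t₂ t₃) (h₄ : IsRound e t₃ t₄) :
    ∃ i, Married (e.conf t₄) i ∧ ¬ Married (e.conf t₀) i := by
  by_contra! hno
  have l₁ := h₁.1.1
  have l₂ := h₂.1.1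
  have l₃ := h₃.1.1
  have l₄ := h₄.1.1
  have hlen := h₄.1.2.1
  have hle : ∀ {t}, t ≤ t₄ → (t : ℕ∞) ≤ e.length := fun h =>
    le_trans (by exact_mod_cast h) hlen
  have hstep : ∀ {t}, t < t₄ → Step (e.conf t) (e.act t) (e.conf (t + 1)) := fun h =>
    e.step' h hlen
  have hM : ∀ t, t₀ ≤ t → t < t₄ →
      ∀ k, Married (e.conf (t + 1)) k ↔ Married (e.conf t) k := by
    intro t h h' k
    refine ⟨fun hk => married_mono e h (hle h'.le) (hno k (married_mono e h' hlen hk)), ?_⟩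
    exact (hstep h').married
  have hcor : ∀ t, t₁ ≤ t → t ≤ t₄ → ∀ k, MCorrect (e.conf t) k :=
    forall_of_step (fun t h h' hc k => (hstep h').mcorrect (hM t (by omega) h') (hc k))
      (h₁.mcorrect fun t h h' => hM t h (by omega))
  have hset₂ : ∀ k, ¬ Married (e.conf t₂) k → Settled (e.conf t₂) k := by
    intro k
    refine h₂.reaches k (fun t => ¬ Married (e.conf t) k → Settled (e.conf t) k) ?_ ?_ ?_
    · intro t h h' hQ
      push Not at hQ
      exact eligible_of_not_settled (hcor t h (by omega)) hQ.1 hQ.2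
    · intro t h h' hQ hk
      have hM' := hM t (by omega) (by omega)
      exact (hstep (by omega)).settled hM' (hQ fun hk' => hk ((hM' k).2 hk'))
    · intro t h h' r hr _
      exact (hstep (by omega)).settled_of_act (hM t (by omega) (by omega)) hr
        (hcor t h (by omega) k)
  have hset : ∀ t, t₂ ≤ t → t ≤ t₄ → ∀ k, ¬ Married (e.conf t) k → Settled (e.conf t) k :=
    forall_of_step (fun t h h' hs k hk => by
      have hM' := hM t (by omega) h'
      exact (hstep h').settled hM' (hs k fun hk' => hk ((hM' k).2 hk'))) hset₂
  -- The step after the second round can only be a marriage move or a seduction.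
  obtain ⟨i, j, hi, hij⟩ : ∃ i j, ¬ Married (e.conf (t₂ + 1)) i ∧
      (e.conf (t₂ + 1)).p i = some j := by
    have hst := hstep (t := t₂) (by omega)
    have hM' := hM t₂ (by omega) (by omega)
    obtain ⟨i, r, hr⟩ := hst.1
    obtain ⟨hg, hc⟩ := hst.2.1 i r hr
    cases r with
    | update => exact absurd (hcor t₂ (by omega) (by omega) i) hg
    | marriage =>
      obtain ⟨-, k, -, -, hk⟩ := hc
      exact ⟨i, k, fun h => not_married_of_none hg.2.1 ((hM' i).1 h), hk⟩
    | seduction =>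
      obtain ⟨-, k, -, hk⟩ := hc
      exact ⟨i, k, fun h => not_married_of_none hg.2.1 ((hM' i).1 h), hk⟩
    | abandonment =>
      exact absurd (hset₂ i hg.not_settled.1) hg.not_settled.2
  have hkeep : ∀ t, t₂ + 1 ≤ t → t ≤ t₃ →
      ¬ Married (e.conf t) i ∧ (e.conf t).p i = some j :=
    forall_of_step (fun t h h' hp =>
      ⟨fun hm => hp.1 ((hM t (by omega) (by omega) i).1 hm),
        (hstep (by omega)).settled_pointer (hset t (by omega) (by omega) i hp.1) hp.2⟩)
      ⟨hi, hij⟩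
  obtain ⟨hi₃, hij₃⟩ := hkeep t₃ l₃ le_rfl
  obtain ⟨x, y, hxy, hy⟩ := exists_pointed_null (hset t₃ (by omega) (by omega)) hi₃ hij₃
  have hnone : ∀ t, t₃ ≤ t → t < t₄ → (e.conf t).p x = some y → (e.conf t).p y = none →
      e.act t y = none := fun t h h' hx hy =>
    (hstep h').act_eq_none (hM t (by omega) h') (hcor t (by omega) h'.le)
      (hset t (by omega) h'.le) hy hx
  have hwait : ∀ t, t₃ ≤ t → t ≤ t₄ → (e.conf t).p x = some y ∧ (e.conf t).p y = none :=
    forall_of_step (fun t h h' hp => by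
      have hux : ¬ Married (e.conf t) x := fun hm => by simpa [hp.2] using hm.back hp.1
      exact ⟨(hstep h').settled_pointer (hset t (by omega) h'.le x hux) hp.1,
        ((hstep h').2.2 y (hnone t h h' hp.1 hp.2)).1.trans hp.2⟩) ⟨hxy, hy⟩
  -- So `y` is able to marry, but does not move, throughout the fourth round.
  refine h₄.reaches y (fun _ => False) (fun t h h' _ => ?_) (fun _ _ _ => id) ?_
  · obtain ⟨h1, h2⟩ := hwait t h h'
    exact ⟨.marriage, hcor t (by omega) h' y, h2, x, ((e.conf t).p_adj x y h1).symm, h1⟩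
  · intro t h h' r hr
    obtain ⟨h1, h2⟩ := hwait t h h'.le
    simp [hnone t h h' h1 h2] at hr

lemma RoundsEnd.le_length {k : ℕ} (h : RoundsEnd e k t) : (t : ℕ∞) ≤ e.length := by
  cases h with
  | zero => simp
  | succ _ hr => exact hr.1.2.1

/-- In a finite computation a round starts in every configuration but the last. -/
lemma exists_isRound {L : ℕ} (hL : (L : ℕ∞) = e.length) (ha : a < L) : ∃ b, IsRound e a b := by
  have hne : {b : ℕ | a < b ∧ (b : ℕ∞) ≤ e.length ∧ ∀ i, Eligible (e.conf a) i →
      (∃ t, a ≤ t ∧ t < b ∧ ∃ r, e.act t i = some r) ∨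
      (∃ t, a ≤ t ∧ t ≤ b ∧ ¬ Eligible (e.conf t) i)}.Nonempty :=
    ⟨L, ha, hL.le, fun i _ => Or.inr ⟨L, ha.le, le_rfl, e.maximal L hL i⟩⟩
  exact ⟨_, Nat.sInf_mem hne, fun b hb => Nat.sInf_le hb⟩

end Rounds

/-! ### Counting married processes -/

variable [Fintype V]

/-- Married processes come in pairs, and so do newly married ones. -/
lemma card_marriedSet_add_two_le {e : Computation G} {s t : ℕ} (hst : s ≤ t)
    (ht : (t : ℕ∞) ≤ e.length) {i : V} (hi : Married (e.conf t) i)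
    (hni : ¬ Married (e.conf s) i) :
    (marriedSet (e.conf s)).card + 2 ≤ (marriedSet (e.conf t)).card := by
  obtain ⟨j, hadj, hij, hji⟩ := hi
  -- If `j` was married before, then it already pointed at its final partner `i`.
  have hnj : ¬ Married (e.conf s) j := by
    rintro ⟨k, hk, hjk, hkj⟩
    obtain rfl : k = i := by simpa [(pair_mono e hst ht hjk hkj).1] using hji
    exact hni ⟨j, hadj, hkj, hjk⟩
  have hcard : (insert i (insert j (marriedSet (e.conf s)))).card =
      (marriedSet (e.conf s)).card + 2 := by
    rw [Finset.card_insert_of_notMem, Finset.card_insert_of_notMem]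
    · simpa using hnj
    · simp [hadj.ne, hni]
  rw [← hcard]
  refine Finset.card_le_card fun k hk => ?_
  simp only [Finset.mem_insert, mem_marriedSet] at hk ⊢
  rcases hk with rfl | rfl | hk
  · exact ⟨j, hadj, hij, hji⟩
  · exact ⟨_, hadj.symm, hji, hij⟩
  · exact married_mono e hst ht hk

lemma two_mul_le_card_marriedSet {e : Computation G} (q : ℕ) {t : ℕ}
    (h : RoundsEnd e (4 * q) t) : 2 * q ≤ (marriedSet (e.conf t)).card := by
  induction q generalizing t with
  | zero => simp
  | succ q ih =>
    have hlen := h.le_length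
    obtain _ | ⟨h, r₄⟩ := (show RoundsEnd e (4 * q + 3 + 1) t from h)
    obtain _ | ⟨h, r₃⟩ := (show RoundsEnd e (4 * q + 2 + 1) _ from h)
    obtain _ | ⟨h, r₂⟩ := (show RoundsEnd e (4 * q + 1 + 1) _ from h)
    obtain _ | ⟨h, r₁⟩ := (show RoundsEnd e (4 * q + 1) _ from h)
    obtain ⟨i, hi, hni⟩ := exists_new_married r₁ r₂ r₃ r₄
    have hle := r₁.1.1.le.trans (r₂.1.1.le.trans (r₃.1.1.le.trans r₄.1.1.le))
    have := card_marriedSet_add_two_le hle hlen hi hni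
    have := ih h
    omega

/-- If `2 n + 1` rounds exist, the computation ends with them. -/
lemma RoundsEnd.stable {e : Computation G} {t : ℕ}
    (h : RoundsEnd e (2 * Fintype.card V + 1) t) : Stable (e.conf t) := by
  rcases Nat.even_or_odd' (Fintype.card V) with ⟨q, hq | hq⟩
  · rw [hq] at h
    obtain _ | ⟨h, hr⟩ := (show RoundsEnd e (2 * (2 * q) + 1) t from h)
    rename_i s
    have hcard := two_mul_le_card_marriedSet q (by convert h using 1; omega)
    have hall : ∀ u, s ≤ u → u ≤ t → ∀ k, Married (e.conf u) k := by
      intro u hsu hut k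
      refine married_mono e hsu (le_trans (by exact_mod_cast hut) hr.1.2.1) ?_
      have huniv : marriedSet (e.conf s) = Finset.univ :=
        Finset.eq_univ_of_card _ (le_antisymm (Finset.card_le_univ _) (by omega))
      rw [← mem_marriedSet, huniv]
      exact Finset.mem_univ k
    have hcor : ∀ k, MCorrect (e.conf t) k := hr.mcorrect fun u hsu hut k =>
      iff_of_true (hall (u + 1) (by omega) hut k) (hall u hsu hut.le k)
    rintro i ⟨r, hg⟩
    have hi := hall t hr.1.1.le le_rfl i
    cases r with
    | update => exact hg (hcor i)
    | marriage => exact not_married_of_none hg.2.1 hi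
    | seduction => exact not_married_of_none hg.2.1 hi
    | abandonment => exact hg.not_settled.1 hi
  · obtain ⟨L, hL⟩ := exists_length_eq e
    have htL : t ≤ L := by exact_mod_cast hL ▸ h.le_length
    rcases htL.eq_or_lt with rfl | hlt
    · exact e.maximal t hL
    -- Otherwise there would be more married processes than processes.
    · obtain ⟨b, hb⟩ := exists_isRound hL hlt
      have hend := RoundsEnd.succ h hb
      have hcard := two_mul_le_card_marriedSet (q + 1) (by convert hend using 1; omega)
      have := Finset.card_le_univ (marriedSet (e.conf b))
      omega

lemma exists_roundsEnd_stable (e : Computation G) :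
    ∃ k ≤ 2 * Fintype.card V + 1, ∃ t : ℕ, RoundsEnd e k t ∧ Stable (e.conf t) := by
  obtain ⟨L, hL⟩ := exists_length_eq e
  by_contra! hno
  have hex : ∀ k ≤ 2 * Fintype.card V + 1, ∃ t, RoundsEnd e k t := by
    intro k hk
    induction k with
    | zero => exact ⟨0, .zero⟩
    | succ k ih =>
      obtain ⟨t, ht⟩ := ih (by omega)
      have htL : t ≤ L := by exact_mod_cast hL ▸ ht.le_length
      rcases htL.eq_or_lt with rfl | hlt
      · exact absurd (e.maximal t hL) (hno k (by omega) t ht)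
      · obtain ⟨b, hb⟩ := exists_isRound hL hlt
        exact ⟨b, ht.succ hb⟩
  obtain ⟨t, ht⟩ := hex _ le_rfl
  exact hno _ le_rfl t ht ht.stable

end SelfStab

theorem mainTheorem3 {V : Type*} [Fintype V] [LinearOrder V] (G : SimpleGraph V)
    (e : SelfStab.Computation G) (he : SelfStab.fairDistributed G e) :
    ∃ k ≤ 2 * Fintype.card V + 1, ∃ t : ℕ,
      SelfStab.RoundsEnd e k t ∧ SelfStab.Stabilized (e.conf t) := by
  obtain ⟨k, hk, t, ht, hs⟩ := SelfStab.exists_roundsEnd_stable e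
  exact ⟨k, hk, t, ht, hs.stabilized⟩
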